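/- Let $d\ge 1$ be an integer and $N=d(d+3)/2$. A convex body in $\mathbb{R}^d$ is a non-empty compact convex set (in particular, compact convex sets with non-empty interior are allowed), and an ellipsoid in $\mathbb{R}^d$ is the image of the closed Euclidean unit ball under an invertible affine map of $\mathbb{R}^d$. Let $\mathcal{C}_1,\dots,\mathcal{C}_N$ be finite families of convex bodies in $\mathbb{R}^d$, and assume that for every colorful selection $C_1\in\mathcal{C}_1,\dots,C_N\in\mathcal{C}_N$, the intersection $\bigcap_{i=1}^{N} C_i$ contains an ellipsoid of volume $1$. Then for some $j\in\{1,\dots,N\}$, the intersection $\bigcap_{C\in\mathcal{C}_j} C$ contains an ellipsoid of volume $1$. (The intersection of an empty family is $\mathbb{R}^d$.) -/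

import Mathlib

/-- A (solid, closed, non-degenerate) ellipsoid in `ℝᵈ`: the image of the closed Euclidean unit ball
under an invertible affine map of `ℝᵈ`. -/
def IsEllipsoid {d : ℕ} (S : Set (EuclideanSpace ℝ (Fin d))) : Prop :=
  ∃ φ : EuclideanSpace ℝ (Fin d) ≃ᵃ[ℝ] EuclideanSpace ℝ (Fin d),
    S = φ '' Metric.closedBall (0 : EuclideanSpace ℝ (Fin d)) 1

/-- The set `X ⊆ ℝᵈ` contains an ellipsoid of volume `1` (Lebesgue measure). -/
def ContainsEllipsoidOfVolumeOne {d : ℕ} (X : Set (EuclideanSpace ℝ (Fin d))) : Prop :=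
  ∃ S : Set (EuclideanSpace ℝ (Fin d)),
    IsEllipsoid S ∧ MeasureTheory.volume S = 1 ∧ S ⊆ X

/-!
# A colourful Helly theorem for ellipsoids of volume one

An ellipsoid is written as `L B + c`, with `B` the unit ball, `L` lower triangular with positive
diagonal, and `c` its centre (`EllipsoidParam.exists_image_point_eq`). The pairs `(L, c)` form a
Euclidean space of dimension `N = d (d + 3) / 2`. In these coordinates the ellipsoids inscribed in a
convex set form a convex set, and so do those with `det L = ∏ Lᵢᵢ ≥ w`, by AM-GM.

The colourful Helly theorem in dimension `N` would need `N + 1` colours. Following Lovász, one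
minimises the norm of `(L, c)` over the ellipsoids of determinant at least `w` inscribed in all
bodies of a selection, and chooses a selection omitting one colour for which this minimum is largest
(`exists_mem_common_of_dispensable`); the minimiser then lies in all bodies of the omitted colour.
This requires that, in a selection of `N` bodies, one of them can be dropped without changing the
minimum (`exists_dispensable_constraint`). That holds because the determinant is smooth: near the
minimiser `p`, the condition `det ≥ w` may be replaced by its linearisation, and since the ellipsoid
collapsed to its centre is a shorter admissible point beyond the tangent hyperplane, Helly's theorem
can be applied inside that hyperplane, of dimension `N - 1`.

Replacing `det ≥ w` by its linearisation needs an inscribed ellipsoid of determinant strictly larger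
than `w`. Hence the argument is run with a determinant slightly smaller than that of an ellipsoid of
volume `1`, and compactness removes the loss (`EllipsoidParam.exists_lt_disjoint_detGE`).
-/

open Module Filter Topology

/-! ### Convex constraints at a point of minimal norm -/

theorem norm_add_smul_sub_lt {V : Type*} [NormedAddCommGroup V] [NormedSpace ℝ V] {p q : V}
    {t : ℝ} (hq : ‖q‖ < ‖p‖) (ht0 : 0 < t) (ht1 : t ≤ 1) : ‖p + t • (q - p)‖ < ‖p‖ := by
  calc ‖p + t • (q - p)‖ = ‖(1 - t) • p + t • q‖ := by congr 1; module
    _ ≤ ‖(1 - t) • p‖ + ‖t • q‖ := norm_add_le _ _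
    _ = (1 - t) * ‖p‖ + t * ‖q‖ := by
      rw [norm_smul, norm_smul, Real.norm_of_nonneg (by linarith), Real.norm_of_nonneg ht0.le]
    _ < ‖p‖ := by nlinarith

/-- Let `p` have minimal norm among the points of `G` satisfying `dim V` convex constraints `F k`,
and let `g = g p` be a hyperplane supporting `G` at `p`, such that `G` contains an initial piece of
every segment from `p` strictly into the open half-space `g > g p`. If the constraints are met by
some point `q` shorter than `p` on the wrong side of the hyperplane and by some point `s` strictly
inside, then one of the constraints can be dropped without lowering the minimal norm.

The point `q` serves to move points of `G` into the hyperplane, so that Helly's theorem can be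
applied in dimension `dim V - 1`; the point `s` serves to move the result back into `G`. -/
theorem exists_dispensable_constraint {V κ : Type*} [NormedAddCommGroup V] [NormedSpace ℝ V]
    [FiniteDimensional ℝ V] [Fintype κ] (hκ : Fintype.card κ = finrank ℝ V)
    {F : κ → Set V} (hF : ∀ k, Convex ℝ (F k)) {G : Set V} {p : V} (hpF : ∀ k, p ∈ F k)
    (hmin : ∀ x ∈ G, (∀ k, x ∈ F k) → ‖p‖ ≤ ‖x‖)
    (g : V →ₗ[ℝ] ℝ) (hG : ∀ x ∈ G, g p ≤ g x)
    (hcone : ∀ x, g p < g x → ∀ᶠ t : ℝ in 𝓝[>] 0, p + t • (x - p) ∈ G)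
    {q : V} (hqF : ∀ k, q ∈ F k) (hq : ‖q‖ < ‖p‖) (hgq : g q < g p)
    {s : V} (hsF : ∀ k, s ∈ F k) (hgs : g p < g s) :
    ∃ i, ∀ x ∈ G, (∀ k, k ≠ i → x ∈ F k) → ‖p‖ ≤ ‖x‖ := by
  classical
  by_contra! hcon
  choose y hyG hyF hy using hcon
  -- It suffices to find a shorter point of the tangent hyperplane satisfying all constraints.
  -- For `s'` on the segment from `r` to `s` and close to `r`, the points of the segment from `p` to
  -- `s'` near `p` lie in `G`, satisfy all constraints and are shorter than `p`.
  suffices hr : ∃ r, (∀ k, r ∈ F k) ∧ ‖r‖ < ‖p‖ ∧ g r = g p by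
    obtain ⟨r, hrF, hr, hgr⟩ := hr
    have h1 : ∀ᶠ η : ℝ in 𝓝[>] 0, ‖r + η • (s - r)‖ < ‖p‖ := by
      have : Tendsto (fun η : ℝ => ‖r + η • (s - r)‖) (𝓝 0) (𝓝 ‖r + (0 : ℝ) • (s - r)‖) :=
        Continuous.tendsto (by fun_prop) 0
      rw [zero_smul, add_zero] at this
      exact (this.mono_left nhdsWithin_le_nhds).eventually_lt_const hr
    have h01 : ∀ᶠ η : ℝ in 𝓝[>] 0, η ∈ Set.Ioo (0 : ℝ) 1 := Ioo_mem_nhdsGT one_pos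
    obtain ⟨η, hη1, hη0, hη⟩ := (h1.and h01).exists
    set s' := r + η • (s - r) with hs'
    have hs'F : ∀ k, s' ∈ F k := fun k =>
      (hF k).add_smul_sub_mem (hrF k) (hsF k) ⟨hη0.le, hη.le⟩
    have hgs' : g p < g s' := by
      simp only [hs', map_add, map_smul, map_sub, smul_eq_mul, hgr]
      nlinarith
    obtain ⟨t, htG, ht0, ht1⟩ := ((hcone s' hgs').and h01).exists
    refine absurd (hmin _ htG fun k => (hF k).add_smul_sub_mem (hpF k) (hs'F k) ⟨ht0.le, ht1.le⟩)
      (not_le.2 ?_)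
    exact norm_add_smul_sub_lt hη1 ht0 ht1.le
  -- Each `y i` lies on the side `g ≥ g p` and is pulled back into the tangent hyperplane along
  -- the segment to `q`.
  have hz : ∀ i, ∃ z, (∀ k, k ≠ i → z ∈ F k) ∧ ‖z‖ < ‖p‖ ∧ g z = g p := by
    intro i
    have hgy := hG _ (hyG i)
    have hpos : 0 < g (y i) - g q := by linarith
    set t := (g p - g q) / (g (y i) - g q) with ht
    have ht0 : 0 ≤ t := div_nonneg (by linarith) hpos.le
    have ht1 : t ≤ 1 := (div_le_one hpos).2 (by linarith)
    refine ⟨q + t • (y i - q), fun k hk => (hF k).add_smul_sub_mem (hqF k) (hyF i k hk) ⟨ht0, ht1⟩,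
      ?_, ?_⟩
    · have := (convex_ball (0 : V) ‖p‖).add_smul_sub_mem (x := q) (y := y i) (by simpa using hq)
        (by simpa using hy i) ⟨ht0, ht1⟩
      simpa using this
    · simp only [map_add, map_smul, map_sub, smul_eq_mul]
      rw [ht, div_mul_cancel₀ _ hpos.ne']; ring
  choose z hzF hz hgz using hz
  have hg0 : g ≠ 0 := by rintro rfl; simp at hgq
  have hrank : finrank ℝ (LinearMap.ker g) + 1 = Fintype.card κ := by
    rw [hκ]; exact Module.Dual.finrank_ker_add_one_of_ne_zero hg0
  -- Helly's theorem in the hyperplane, for the constraints together with an open ball.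
  let H : Option κ → Set (LinearMap.ker g) := fun o =>
    o.elim {v | ‖p + v‖ < ‖p‖} fun k => {v | p + v ∈ F k}
  have hH : ∀ o ∈ (Finset.univ : Finset (Option κ)), Convex ℝ (H o) := by
    rintro (_ | k) -
    · have : H none = (fun v : LinearMap.ker g => p + v) ⁻¹' Metric.ball 0 ‖p‖ := by
        ext; simp [H]
      rw [this]
      exact ((convex_ball (0 : V) ‖p‖).translate_preimage_right p).linear_preimage
        (LinearMap.ker g).subtype
    · exact ((hF k).translate_preimage_right p).linear_preimage (LinearMap.ker g).subtype
  obtain ⟨v, hv⟩ := Convex.helly_theorem (s := Finset.univ) (F := H) (𝕜 := ℝ)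
    (by rw [Finset.card_univ, Fintype.card_option]; omega) hH (by
      intro I _ hI
      obtain ⟨o, ho⟩ : ∃ o, o ∉ I := by
        by_contra! hall
        have := Finset.eq_univ_iff_forall.2 hall ▸ hI
        rw [Finset.card_univ, Fintype.card_option] at this; omega
      rcases o with _ | i
      · refine ⟨0, Set.mem_iInter₂.2 ?_⟩
        rintro (_ | k) hk
        · exact absurd hk ho
        · simpa [H] using hpF k
      · refine ⟨⟨z i - p, by simp [hgz]⟩, Set.mem_iInter₂.2 ?_⟩
        rintro (_ | k) hk
        · simpa [H] using hz i
        · have : k ≠ i := by rintro rfl; exact ho hk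
          simpa [H] using hzF i k this)
  rw [Set.mem_iInter₂] at hv
  refine ⟨p + v, fun k => hv (some k) (Finset.mem_univ _), hv none (Finset.mem_univ _), ?_⟩
  simp [LinearMap.mem_ker.1 v.2]

/-- Lovász' argument for colourful Helly theorems. Among all selections with one colour omitted,
take one whose minimal norm over `G` is largest. If in every complete selection some colour can be
dropped without lowering the minimal norm, then the minimiser belongs to all members of the omitted
colour. -/
theorem exists_mem_common_of_dispensable {V κ β : Type*} [NormedAddCommGroup V] [NormedSpace ℝ V]
    [StrictConvexSpace ℝ V] [ProperSpace V] [Finite κ] [Nonempty κ] {𝒞 : κ → Finset β}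
    (h𝒞 : ∀ k, (𝒞 k).Nonempty) {Φ : β → Set V} (hconv : ∀ C, Convex ℝ (Φ C))
    (hclosed : ∀ C, IsClosed (Φ C)) {G : Set V} (hGconv : Convex ℝ G) (hGclosed : IsClosed G)
    (hne : ∀ S : κ → β, (∀ k, S k ∈ 𝒞 k) → ∃ x ∈ G, ∀ k, x ∈ Φ (S k))
    (hdrop : ∀ S : κ → β, (∀ k, S k ∈ 𝒞 k) → ∀ p ∈ G, (∀ k, p ∈ Φ (S k)) →
      (∀ x ∈ G, (∀ k, x ∈ Φ (S k)) → ‖p‖ ≤ ‖x‖) →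
      ∃ i, ∀ x ∈ G, (∀ k, k ≠ i → x ∈ Φ (S k)) → ‖p‖ ≤ ‖x‖) :
    ∃ j, ∃ p ∈ G, ∀ C ∈ 𝒞 j, p ∈ Φ C := by
  classical
  have := Fintype.ofFinite κ
  have hex : ∀ A : Set V, IsClosed A → A.Nonempty → ∃ p ∈ A, ∀ x ∈ A, ‖p‖ ≤ ‖x‖ := by
    intro A hA hA'
    obtain ⟨p, hp, hd⟩ := hA.exists_infDist_eq_dist hA' 0
    refine ⟨p, hp, fun x hx => ?_⟩
    rw [← dist_zero_left p, ← dist_zero_left x, ← hd]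
    exact Metric.infDist_le_dist_of_mem hx
  have hclosed' : ∀ (S : κ → β) (P : κ → Prop), IsClosed {x | x ∈ G ∧ ∀ k, P k → x ∈ Φ (S k)} := by
    intro S P
    have : {x | x ∈ G ∧ ∀ k, P k → x ∈ Φ (S k)} = G ∩ ⋂ k, ⋂ _ : P k, Φ (S k) := by
      ext; simp
    rw [this]
    exact hGclosed.inter (isClosed_iInter fun k => isClosed_iInter fun _ => hclosed _)
  let I := {S : κ → β // ∀ k, S k ∈ 𝒞 k}
  have hfin : Finite I :=
    Finite.of_injective (fun S : I => fun k => (⟨S.1 k, S.2 k⟩ : 𝒞 k)) fun S T h => by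
      ext k; exact congrArg Subtype.val (congrFun h k)
  have hIne : Nonempty I := ⟨⟨fun k => (h𝒞 k).choose, fun k => (h𝒞 k).choose_spec⟩⟩
  have hm : ∀ a : κ × I, ∃ p ∈ {x | x ∈ G ∧ ∀ k, k ≠ a.1 → x ∈ Φ (a.2.1 k)},
      ∀ x ∈ {x | x ∈ G ∧ ∀ k, k ≠ a.1 → x ∈ Φ (a.2.1 k)}, ‖p‖ ≤ ‖x‖ := by
    intro a
    obtain ⟨x, hx, hx'⟩ := hne a.2.1 a.2.2
    exact hex _ (hclosed' _ _) ⟨x, hx, fun k _ => hx' k⟩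
  choose m hmA hmle using hm
  obtain ⟨⟨j, S⟩, hmax⟩ := Finite.exists_max fun a => ‖m a‖
  refine ⟨j, m (j, S), (hmA (j, S)).1, fun C hC => ?_⟩
  -- Complete the partial selection avoiding colour `j` by `C`.
  let S' : I := ⟨Function.update S.1 j C, fun k => by
    by_cases hk : k = j
    · subst hk; simpa using hC
    · simpa [hk] using S.2 k⟩
  obtain ⟨x₀, hx₀, hx₀'⟩ := hne S'.1 S'.2
  obtain ⟨p, ⟨hpG, hpF⟩, hpmin⟩ := hex {x | x ∈ G ∧ ∀ k, True → x ∈ Φ (S'.1 k)} (hclosed' _ _)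
    ⟨x₀, hx₀, fun k _ => hx₀' k⟩
  have hpF' : ∀ k, p ∈ Φ (S'.1 k) := fun k => hpF k trivial
  obtain ⟨i, hi⟩ := hdrop S'.1 S'.2 p hpG hpF' fun x hx hx' => hpmin x ⟨hx, fun k _ => hx' k⟩
  have hle : ‖p‖ ≤ ‖m (j, S)‖ :=
    (hi _ (hmA (i, S')).1 (hmA (i, S')).2).trans (hmax (i, S'))
  have hpS : p ∈ {x | x ∈ G ∧ ∀ k, k ≠ j → x ∈ Φ (S.1 k)} :=
    ⟨hpG, fun k hk => by simpa [S', hk] using hpF' k⟩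
  have heq : ‖p‖ = ‖m (j, S)‖ := le_antisymm hle (hmle (j, S) p hpS)
  -- Both points have minimal norm in the same convex set, so strict convexity identifies them.
  have : p = m (j, S) := by
    by_contra hpm
    have hmS := hmA (j, S)
    have hmid := hmle (j, S) ((1 / 2 : ℝ) • p + (1 / 2 : ℝ) • m (j, S))
      ⟨hGconv hpS.1 hmS.1 (by norm_num) (by norm_num) (by norm_num), fun k hk =>
        hconv _ (hpS.2 k hk) (hmS.2 k hk) (by norm_num) (by norm_num) (by norm_num)⟩
    exact absurd (norm_combo_lt_of_ne heq.le le_rfl hpm (by norm_num) (by norm_num) (by norm_num))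
      (not_lt.2 hmid)
  simpa [S', ← this] using hpF' j

/-! ### Two inequalities for products -/

/-- A form of the AM-GM inequality, from `log t ≤ t - 1`. -/
theorem card_add_log_prod_le_sum {ι : Type*} [Fintype ι] {y : ι → ℝ} (hy : ∀ i, 0 ≤ y i)
    (h : 1 ≤ ∏ i, y i) : (Fintype.card ι : ℝ) + Real.log (∏ i, y i) ≤ ∑ i, y i := by
  have h0 : ∀ i, y i ≠ 0 := fun i hi => by
    rw [Finset.prod_eq_zero (Finset.mem_univ i) hi] at h; norm_num at h
  have : ∑ i, Real.log (y i) ≤ ∑ i, (y i - 1) := Finset.sum_le_sum fun i _ =>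
    Real.log_le_sub_one_of_pos ((hy i).lt_of_ne' (h0 i))
  rw [Real.log_prod fun i _ => h0 i]
  simp only [Finset.sum_sub_distrib, Finset.sum_const, Finset.card_univ, nsmul_eq_mul,
    mul_one] at this
  linarith

theorem eventually_one_le_prod_one_add_mul {ι : Type*} [Fintype ι] {a : ι → ℝ}
    (ha : 0 < ∑ i, a i) : ∀ᶠ t : ℝ in 𝓝[>] 0, 1 ≤ ∏ i, (1 + t * a i) := by
  classical
  have hd : HasDerivAt (fun t : ℝ => ∏ i, (1 + t * a i)) (∑ i, a i) 0 := by
    have := HasDerivAt.fun_finsetProd (u := Finset.univ) (f := fun i (t : ℝ) => 1 + t * a i)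
      (f' := a) (x := (0 : ℝ)) fun i _ => by
        simpa using ((hasDerivAt_id (0 : ℝ)).mul_const (a i)).const_add 1
    simpa using this
  have hs := (hasDerivAt_iff_tendsto_slope.1 hd).eventually_const_lt ha
  have hs' : ∀ᶠ t : ℝ in 𝓝[>] 0, 0 < slope (fun t : ℝ => ∏ i, (1 + t * a i)) 0 t :=
    hs.filter_mono (nhdsWithin_mono _ fun t (ht : 0 < t) => ht.ne')
  filter_upwards [hs', self_mem_nhdsWithin] with t ht ht0
  rw [slope_def_field, sub_zero] at ht
  have := (div_pos_iff_of_pos_right ht0).1 ht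
  simp at this
  linarith

/-! ### The parameter space of ellipsoids -/

/-- The parameter space of ellipsoids: the coordinate `Sum.inl (j, i)`, with `j ≤ i`, is the entry
in row `i` and column `j` of a lower triangular matrix, and the coordinates `Sum.inr i` are those
of the centre. Its dimension is the number of colours. -/
abbrev EllipsoidParam (d : ℕ) : Type :=
  EuclideanSpace ℝ ({p : Fin d × Fin d // p.1 ≤ p.2} ⊕ Fin d)

namespace EllipsoidParam

variable {d : ℕ}

theorem finrank_eq (d : ℕ) : finrank ℝ (EllipsoidParam d) = d * (d + 3) / 2 := by
  rw [finrank_euclideanSpace, Fintype.card_sum, ← Fintype.card_congr Sym2.sortEquiv, Sym2.card,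
    Fintype.card_fin, Nat.choose_two_right, Nat.add_sub_cancel,
    ← Nat.add_mul_div_right _ _ two_pos]
  congr 1; ring

/-- The lower triangular matrix of a parameter. -/
def toMatrix (x : EllipsoidParam d) : Matrix (Fin d) (Fin d) ℝ :=
  Matrix.of fun i j => if h : j ≤ i then x (Sum.inl ⟨(j, i), h⟩) else 0

/-- The diagonal entries of the matrix of a parameter. -/
def diag (x : EllipsoidParam d) (i : Fin d) : ℝ := x (Sum.inl ⟨(i, i), le_rfl⟩)

/-- The centre of the ellipsoid with a given parameter. -/
noncomputable def center (x : EllipsoidParam d) : EuclideanSpace ℝ (Fin d) :=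
  WithLp.toLp 2 fun i => x (Sum.inr i)

/-- The point `L u + c` of the ellipsoid with parameter `(L, c)` corresponding to the point `u` of
the unit ball, as a linear function of the parameter. -/
noncomputable def point (u : EuclideanSpace ℝ (Fin d)) :
    EllipsoidParam d →ₗ[ℝ] EuclideanSpace ℝ (Fin d) where
  toFun x := Matrix.toEuclideanLin (toMatrix x) u + center x
  map_add' x y := by
    have : toMatrix (x + y) = toMatrix x + toMatrix y := by
      ext i j; by_cases h : j ≤ i <;> simp [toMatrix, h]
    have h2 : center (x + y) = center x + center y := by ext; simp [center]
    rw [this, h2, map_add, LinearMap.add_apply]; abel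
  map_smul' t x := by
    have : toMatrix (t • x) = t • toMatrix x := by
      ext i j; by_cases h : j ≤ i <;> simp [toMatrix, h]
    have h2 : center (t • x) = t • center x := by ext; simp [center]
    rw [this, h2, map_smul, LinearMap.smul_apply, smul_add, RingHom.id_apply]

theorem point_apply (u : EuclideanSpace ℝ (Fin d)) (x : EllipsoidParam d) :
    point u x = Matrix.toEuclideanLin (toMatrix x) u + center x := rfl

theorem point_zero (x : EllipsoidParam d) : point 0 x = center x := by
  rw [point_apply, map_zero, zero_add]

theorem continuous_diag (i : Fin d) : Continuous fun x : EllipsoidParam d => diag x i := by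
  unfold diag; fun_prop

theorem diag_add_smul_sub (x y : EllipsoidParam d) (t : ℝ) (i : Fin d) :
    diag (x + t • (y - x)) i = diag x i + t * (diag y i - diag x i) := by
  simp [diag]

theorem det_toEuclideanLin (x : EllipsoidParam d) :
    LinearMap.det (Matrix.toEuclideanLin (toMatrix x)) = ∏ i, diag x i := by
  have h1 : LinearMap.det (Matrix.toEuclideanLin (toMatrix x)) = (toMatrix x).det := by
    rw [Matrix.toEuclideanLin_eq_toLin_orthonormal, LinearMap.det_toLin]
  rw [h1, Matrix.det_of_isLowerTriangular]
  · simp [toMatrix, diag]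
  · intro i j hij
    have : ¬ j ≤ i := not_le.2 hij
    simp [toMatrix, this]

/-! ### Ellipsoids inscribed in a set -/

/-- The parameters of the (possibly degenerate) ellipsoids contained in `C`. -/
def inscribed (C : Set (EuclideanSpace ℝ (Fin d))) : Set (EllipsoidParam d) :=
  {x | ∀ u ∈ Metric.closedBall (0 : EuclideanSpace ℝ (Fin d)) 1, point u x ∈ C}

theorem inscribed_eq (C : Set (EuclideanSpace ℝ (Fin d))) :
    inscribed C = ⋂ u ∈ Metric.closedBall (0 : EuclideanSpace ℝ (Fin d)) 1, point u ⁻¹' C := by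
  ext; simp [inscribed]

theorem convex_inscribed {C : Set (EuclideanSpace ℝ (Fin d))} (hC : Convex ℝ C) :
    Convex ℝ (inscribed C) := by
  rw [inscribed_eq]
  exact convex_iInter₂ fun u _ => hC.linear_preimage (point u)

theorem isClosed_inscribed {C : Set (EuclideanSpace ℝ (Fin d))} (hC : IsClosed C) :
    IsClosed (inscribed C) := by
  rw [inscribed_eq]
  exact isClosed_biInter fun u _ => hC.preimage (point u).continuous_of_finiteDimensional

/-- The centre and the points `L eⱼ + c` of an inscribed ellipsoid lie in `C`, which bounds all
coordinates of the parameter. -/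
theorem isBounded_inscribed {C : Set (EuclideanSpace ℝ (Fin d))} (hC : Bornology.IsBounded C) :
    Bornology.IsBounded (inscribed C) := by
  obtain ⟨R, hR⟩ := hC.subset_closedBall 0
  have hx : ∀ x ∈ inscribed C, ∀ k, ‖x k‖ ≤ 2 * R := by
    intro x hx k
    have hc : ‖center x‖ ≤ R := by
      simpa [point_zero] using hR (hx 0 (by simp))
    have hR0 : 0 ≤ R := (norm_nonneg _).trans hc
    rcases k with ⟨⟨j, i⟩, hji⟩ | i
    · have h1 : ‖point (EuclideanSpace.single j 1) x‖ ≤ R := by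
        simpa using hR (hx _ (by simp))
      have h2 : ‖point (EuclideanSpace.single j 1) x - center x‖ ≤ 2 * R :=
        (norm_sub_le _ _).trans (by linarith)
      refine le_trans ?_ ((PiLp.norm_apply_le _ i).trans h2)
      have hji' : j ≤ i := hji
      simp [point_apply, Matrix.toLpLin_apply, toMatrix, hji']
    · have : ‖x (Sum.inr i)‖ = ‖center x i‖ := rfl
      rw [this]
      exact (PiLp.norm_apply_le _ i).trans (by linarith)
  refine isBounded_iff_forall_norm_le.2
    ⟨√(∑ _k : {p : Fin d × Fin d // p.1 ≤ p.2} ⊕ Fin d, (2 * R) ^ 2), fun x h => ?_⟩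
  rw [EuclideanSpace.norm_eq]
  gcongr with k
  exact hx x h k

/-! ### Ellipsoids with large determinant -/

/-- The parameters with nonnegative diagonal and determinant at least `w`. The condition on the
diagonal makes this set convex. -/
def detGE (d : ℕ) (w : ℝ) : Set (EllipsoidParam d) :=
  {x | (∀ i, 0 ≤ diag x i) ∧ w ≤ ∏ i, diag x i}

theorem convex_detGE {w : ℝ} (hw : 0 ≤ w) : Convex ℝ (detGE d w) := by
  rintro x ⟨hx, hx'⟩ y ⟨hy, hy'⟩ a b ha hb hab
  have hdiag : ∀ i, diag (a • x + b • y) i = a * diag x i + b * diag y i := by simp [diag]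
  refine ⟨fun i => ?_, ?_⟩
  · rw [hdiag]
    exact add_nonneg (mul_nonneg ha (hx i)) (mul_nonneg hb (hy i))
  calc w = w ^ a * w ^ b := by
        rw [← Real.rpow_add_of_nonneg hw ha hb, hab, Real.rpow_one]
    _ ≤ (∏ i, diag x i) ^ a * (∏ i, diag y i) ^ b :=
        mul_le_mul (Real.rpow_le_rpow hw hx' ha) (Real.rpow_le_rpow hw hy' hb)
          (Real.rpow_nonneg hw b) (Real.rpow_nonneg (hw.trans hx') a)
    _ = ∏ i, (diag x i ^ a * diag y i ^ b) := by
        rw [Finset.prod_mul_distrib, Real.finsetProd_rpow _ _ fun i _ => hx i,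
          Real.finsetProd_rpow _ _ fun i _ => hy i]
    _ ≤ ∏ i, diag (a • x + b • y) i := by
        refine Finset.prod_le_prod (fun i _ => mul_nonneg (Real.rpow_nonneg (hx i) _)
          (Real.rpow_nonneg (hy i) _)) fun i _ => ?_
        rw [hdiag]
        exact Real.geom_mean_le_arith_mean2_weighted ha hb (hx i) (hy i) hab

theorem isClosed_detGE (w : ℝ) : IsClosed (detGE d w) := by
  have : detGE d w = (⋂ i, {x | 0 ≤ diag x i}) ∩ {x | w ≤ ∏ i, diag x i} := by
    ext; simp [detGE]
  rw [this]
  exact (isClosed_iInter fun i => isClosed_le continuous_const (continuous_diag i)).inter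
    (isClosed_le continuous_const (continuous_finsetProd _ fun i _ => continuous_diag i))

theorem detGE_anti {w w' : ℝ} (h : w' ≤ w) : detGE d w ⊆ detGE d w' :=
  fun _ hx => ⟨hx.1, h.trans hx.2⟩

theorem diag_pos {w : ℝ} (hw : 0 < w) {x : EllipsoidParam d} (hx : x ∈ detGE d w) (i : Fin d) :
    0 < diag x i := by
  refine (hx.1 i).lt_of_ne' fun h => ?_
  have := hx.2
  rw [Finset.prod_eq_zero (Finset.mem_univ i) h] at this
  linarith

/-- The parameter of the ellipsoid shrunk to its centre. -/
noncomputable def collapse (x : EllipsoidParam d) : EllipsoidParam d :=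
  WithLp.toLp 2 (Sum.elim 0 fun i => x (Sum.inr i))

theorem point_collapse (u : EuclideanSpace ℝ (Fin d)) (x : EllipsoidParam d) :
    point u (collapse x) = center x := by
  have : toMatrix (collapse x) = 0 := by
    ext i j; by_cases h : j ≤ i <;> simp [toMatrix, collapse]
  rw [point_apply, this, map_zero, LinearMap.zero_apply, zero_add]
  rfl

theorem diag_collapse (x : EllipsoidParam d) (i : Fin d) : diag (collapse x) i = 0 := rfl

theorem collapse_mem_inscribed {C : Set (EuclideanSpace ℝ (Fin d))} {x : EllipsoidParam d}
    (hx : x ∈ inscribed C) : collapse x ∈ inscribed C := fun u _ => by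
  rw [point_collapse, ← point_zero]; exact hx 0 (by simp)

theorem norm_collapse_lt {x : EllipsoidParam d} {i : Fin d} (hi : 0 < diag x i) :
    ‖collapse x‖ < ‖x‖ := by
  rw [EuclideanSpace.norm_eq, EuclideanSpace.norm_eq]
  refine Real.sqrt_lt_sqrt (by positivity) ?_
  rw [Fintype.sum_sum_type, Fintype.sum_sum_type]
  simp only [collapse, Sum.elim_inl, Sum.elim_inr, Pi.zero_apply, norm_zero]
  have h0 : 0 < ∑ k : {p : Fin d × Fin d // p.1 ≤ p.2}, ‖x (Sum.inl k)‖ ^ 2 := by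
    refine Finset.sum_pos' (fun _ _ => by positivity)
      ⟨⟨(i, i), le_rfl⟩, Finset.mem_univ _, ?_⟩
    have : 0 < ‖x (Sum.inl ⟨(i, i), le_rfl⟩)‖ := norm_pos_iff.2 hi.ne'
    positivity
  simpa using h0

/-- The determinant constraint is active at a minimiser of the norm, since shrinking the ellipsoid
towards its centre decreases the norm. -/
theorem prod_diag_eq_of_norm_le {w : ℝ} (hw : 0 < w) (hd : 1 ≤ d) {A : Set (EllipsoidParam d)}
    (hA : Convex ℝ A) {p : EllipsoidParam d} (hp : p ∈ detGE d w) (hpA : p ∈ A)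
    (hcA : collapse p ∈ A) (hmin : ∀ x ∈ detGE d w, x ∈ A → ‖p‖ ≤ ‖x‖) :
    ∏ i, diag p i = w := by
  refine le_antisymm (not_lt.1 fun hlt => ?_) hp.2
  have hlt' := norm_collapse_lt (diag_pos hw hp ⟨0, hd⟩)
  have hcont : Tendsto (fun t : ℝ => ∏ i, diag (p + t • (collapse p - p)) i) (𝓝 0)
      (𝓝 (∏ i, diag (p + (0 : ℝ) • (collapse p - p)) i)) := by
    refine Continuous.tendsto (continuous_finsetProd _ fun i _ => ?_) 0
    exact (continuous_diag i).comp (by fun_prop)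
  rw [zero_smul, add_zero] at hcont
  have h1 := (hcont.mono_left (nhdsWithin_le_nhds (s := Set.Ioi 0))).eventually_const_lt hlt
  have h01 : ∀ᶠ η : ℝ in 𝓝[>] 0, η ∈ Set.Ioo (0 : ℝ) 1 := Ioo_mem_nhdsGT one_pos
  obtain ⟨t, ht, ht0, ht1⟩ := (h1.and h01).exists
  refine absurd (hmin _ ⟨fun i => ?_, ht.le⟩ (hA.add_smul_sub_mem hpA hcA ⟨ht0.le, ht1.le⟩))
    (not_le.2 ?_)
  · rw [diag_add_smul_sub, diag_collapse]
    nlinarith [hp.1 i]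
  exact norm_add_smul_sub_lt hlt' ht0 ht1.le

/-! ### The tangent hyperplane of the determinant -/

/-- The linear functional `x ↦ ∑ i, xᵢᵢ / pᵢᵢ`, the derivative at `p` of the logarithm of the
determinant. -/
noncomputable def tangent (p : EllipsoidParam d) : EllipsoidParam d →ₗ[ℝ] ℝ where
  toFun x := ∑ i, diag x i / diag p i
  map_add' x y := by simp [diag, add_div, Finset.sum_add_distrib]
  map_smul' t x := by simp [diag, mul_div_assoc, Finset.mul_sum]

theorem tangent_apply (p x : EllipsoidParam d) : tangent p x = ∑ i, diag x i / diag p i := rfl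

theorem tangent_self {w : ℝ} (hw : 0 < w) {p : EllipsoidParam d} (hp : p ∈ detGE d w) :
    tangent p p = d := by
  rw [tangent_apply, Finset.sum_congr rfl fun i _ => div_self (diag_pos hw hp i).ne']
  simp

/-- The hyperplane `tangent p x = tangent p p` supports `detGE d w` at `p`, with a quantitative gap
for larger determinants. -/
theorem le_tangent {w w' : ℝ} (hw : 0 < w) (hww : w ≤ w') {p x : EllipsoidParam d}
    (hp : p ∈ detGE d w) (hpw : ∏ i, diag p i = w) (hx : x ∈ detGE d w') :
    d + Real.log (w' / w) ≤ tangent p x := by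
  have hprod : ∏ i, diag x i / diag p i = (∏ i, diag x i) / w := by
    rw [Finset.prod_div_distrib, hpw]
  have h1 : w' / w ≤ ∏ i, diag x i / diag p i := by
    rw [hprod]; gcongr; exact hx.2
  have h2 : 1 ≤ w' / w := (one_le_div hw).2 hww
  have := card_add_log_prod_le_sum (y := fun i => diag x i / diag p i)
    (fun i => div_nonneg (hx.1 i) (hp.1 i)) (h2.trans h1)
  have h3 := Real.log_le_log (by linarith) h1
  rw [Fintype.card_fin] at this
  rw [tangent_apply]
  linarith

theorem eventually_mem_detGE {w : ℝ} (hw : 0 < w) {p x : EllipsoidParam d}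
    (hp : p ∈ detGE d w) (hx : tangent p p < tangent p x) :
    ∀ᶠ t : ℝ in 𝓝[>] 0, p + t • (x - p) ∈ detGE d w := by
  have hpos := diag_pos hw hp
  have hsum : 0 < ∑ i, (diag x i / diag p i - 1) := by
    rw [tangent_self hw hp, tangent_apply] at hx
    simp only [Finset.sum_sub_distrib, Finset.sum_const, Finset.card_univ, Fintype.card_fin,
      nsmul_eq_mul, mul_one]
    linarith
  have hdiag : ∀ i, ∀ᶠ t : ℝ in 𝓝[>] 0, 0 < diag (p + t • (x - p)) i := by
    intro i
    have hcont : Tendsto (fun t : ℝ => diag (p + t • (x - p)) i) (𝓝 0)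
        (𝓝 (diag (p + (0 : ℝ) • (x - p)) i)) :=
      ((continuous_diag i).comp (by fun_prop : Continuous fun t : ℝ => p + t • (x - p))).tendsto 0
    rw [zero_smul, add_zero] at hcont
    exact (hcont.mono_left nhdsWithin_le_nhds).eventually_const_lt (hpos i)
  filter_upwards [eventually_all.2 hdiag, eventually_one_le_prod_one_add_mul hsum] with t ht ht'
  refine ⟨fun i => (ht i).le, ?_⟩
  have : ∏ i, diag (p + t • (x - p)) i =
      (∏ i, diag p i) * ∏ i, (1 + t * (diag x i / diag p i - 1)) := by
    rw [← Finset.prod_mul_distrib]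
    refine Finset.prod_congr rfl fun i _ => ?_
    have := (hpos i).ne'
    rw [diag_add_smul_sub]; field_simp
  rw [this]
  nlinarith [hp.2]

/-! ### Ellipsoids and their volume in terms of parameters -/

/-- Every ellipsoid is given by a lower triangular matrix with nonnegative diagonal. For an
ellipsoid with linear part `M`, Gram-Schmidt applied to the rows of `M` gives an orthonormal basis
`q` such that `M q` is lower triangular, and the unit ball is invariant under the isometry carrying
the standard basis to `q`. -/
theorem exists_image_point_eq (φ : EuclideanSpace ℝ (Fin d) ≃ᵃ[ℝ] EuclideanSpace ℝ (Fin d)) :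
    ∃ x : EllipsoidParam d, (∀ i, 0 ≤ diag x i) ∧
      (fun u => point u x) '' Metric.closedBall 0 1 = φ '' Metric.closedBall 0 1 := by
  let M : EuclideanSpace ℝ (Fin d) →ₗ[ℝ] EuclideanSpace ℝ (Fin d) := φ.linear
  let f : Fin d → EuclideanSpace ℝ (Fin d) := fun i =>
    LinearMap.adjoint M (EuclideanSpace.single i 1)
  have hf : ∀ i v, inner ℝ v (f i) = M v i := fun i v => by
    simp [f, LinearMap.adjoint_inner_right, EuclideanSpace.inner_single_right]
  have hinj : Function.Injective (LinearMap.adjoint M) := by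
    rw [injective_iff_map_eq_zero]
    intro v hv
    obtain ⟨u, hu⟩ := φ.linear.surjective v
    have : inner ℝ u (LinearMap.adjoint M v) = inner ℝ v v := by
      rw [LinearMap.adjoint_inner_right]; congr 1
    rw [hv, inner_zero_right] at this
    exact inner_self_eq_zero.1 this.symm
  have hli : LinearIndependent ℝ f := by
    have := (EuclideanSpace.basisFun (Fin d) ℝ).toBasis.linearIndependent.map'
      (LinearMap.adjoint M) (LinearMap.ker_eq_bot.2 hinj)
    have hfe : f = LinearMap.adjoint M ∘ (EuclideanSpace.basisFun (Fin d) ℝ).toBasis := by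
      ext; simp [f]
    rw [hfe]
    exact this
  let q := InnerProductSpace.gramSchmidtOrthonormalBasis
    (𝕜 := ℝ) (E := EuclideanSpace ℝ (Fin d)) (ι := Fin d) (by simp) f
  have hq : ∀ i j, i < j → inner ℝ (q j) (f i) = 0 := fun i j hij =>
    InnerProductSpace.gramSchmidtOrthonormalBasis_inv_triangular _ f hij
  have hqd : ∀ i, 0 ≤ inner ℝ (q i) (f i) := by
    intro i
    have hne := InnerProductSpace.gramSchmidt_ne_zero (𝕜 := ℝ) i hli
    have hne' : InnerProductSpace.gramSchmidtNormed ℝ f i ≠ 0 := by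
      simp [InnerProductSpace.gramSchmidtNormed, hne]
    have : q i = InnerProductSpace.gramSchmidtNormed ℝ f i :=
      InnerProductSpace.gramSchmidtOrthonormalBasis_apply _ hne'
    rw [this, InnerProductSpace.gramSchmidtNormed, real_inner_smul_left]
    refine mul_nonneg (by simp) ?_
    rw [InnerProductSpace.gramSchmidt_def'' ℝ f i, inner_add_right, inner_sum,
      Finset.sum_eq_zero, add_zero]
    · exact real_inner_self_nonneg
    · intro j hj
      rw [inner_smul_right, InnerProductSpace.gramSchmidt_orthogonal ℝ f (Finset.mem_Iio.1 hj).ne',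
        mul_zero]
  let x : EllipsoidParam d := WithLp.toLp 2
    (Sum.elim (fun p => inner ℝ (q p.1.1) (f p.1.2)) fun i => φ 0 i)
  have hx : Matrix.toEuclideanLin (toMatrix x) = M ∘ₗ (q.repr.symm : _ →ₗ[ℝ] _) := by
    refine (EuclideanSpace.basisFun (Fin d) ℝ).toBasis.ext fun j => ?_
    ext i
    by_cases h : j ≤ i
    · simp [toMatrix, x, h, hf, Matrix.toLpLin_apply]
    · have := hq i j (not_le.1 h)
      rw [hf] at this
      simp [toMatrix, h, Matrix.toLpLin_apply, this]
  have hp : ∀ u, point u x = φ (q.repr.symm u) := by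
    intro u
    have h1 : φ (q.repr.symm u) = M (q.repr.symm u) + φ 0 := by
      have := φ.map_vadd 0 (q.repr.symm u)
      simpa [M] using this
    rw [point_apply, hx, h1]
    rfl
  refine ⟨x, hqd, ?_⟩
  simp_rw [hp]
  rw [show (fun u => φ (q.repr.symm u)) = φ ∘ q.repr.symm from rfl, Set.image_comp,
    LinearIsometryEquiv.image_closedBall, map_zero]

theorem volume_image_point (x : EllipsoidParam d) (s : Set (EuclideanSpace ℝ (Fin d))) :
    MeasureTheory.volume ((fun u => point u x) '' s) =
      ENNReal.ofReal |∏ i, diag x i| * MeasureTheory.volume s := by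
  have : (fun u => point u x) =
      (fun v => v + center x) ∘ Matrix.toEuclideanLin (toMatrix x) := rfl
  rw [this, Set.image_comp, Set.image_add_right, MeasureTheory.measure_preimage_add_right,
    MeasureTheory.Measure.addHaar_image_linearMap, det_toEuclideanLin]

/-- The determinant of the linear part of an ellipsoid of volume `1`. -/
noncomputable def unitDet (d : ℕ) : ℝ :=
  (MeasureTheory.volume (Metric.closedBall (0 : EuclideanSpace ℝ (Fin d)) 1)).toReal⁻¹

theorem unitDet_pos (d : ℕ) : 0 < unitDet d :=
  inv_pos.2 (ENNReal.toReal_pos (Metric.measure_closedBall_pos _ _ one_pos).ne'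
    MeasureTheory.measure_closedBall_lt_top.ne)

theorem ofReal_mul_volume_eq_one {t : ℝ} :
    ENNReal.ofReal t *
      MeasureTheory.volume (Metric.closedBall (0 : EuclideanSpace ℝ (Fin d)) 1) = 1 ↔
      t = unitDet d := by
  have h0 := (Metric.measure_closedBall_pos MeasureTheory.volume
    (0 : EuclideanSpace ℝ (Fin d)) one_pos).ne'
  have ht : MeasureTheory.volume (Metric.closedBall (0 : EuclideanSpace ℝ (Fin d)) 1) ≠ ⊤ :=
    MeasureTheory.measure_closedBall_lt_top.ne
  rw [unitDet, ← ENNReal.toReal_inv]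
  constructor
  · intro h
    rw [← ENNReal.eq_inv_of_mul_eq_one_left h, ENNReal.toReal_ofReal]
    by_contra! hlt
    rw [ENNReal.ofReal_of_nonpos hlt.le, zero_mul] at h
    exact zero_ne_one h
  · rintro rfl
    rw [ENNReal.ofReal_toReal (ENNReal.inv_ne_top.2 h0), ENNReal.inv_mul_cancel h0 ht]

theorem exists_mem_inscribed {X : Set (EuclideanSpace ℝ (Fin d))}
    (h : ContainsEllipsoidOfVolumeOne X) : ∃ x ∈ detGE d (unitDet d), x ∈ inscribed X := by
  obtain ⟨_, ⟨φ, rfl⟩, hv, hX⟩ := h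
  obtain ⟨x, hx, himg⟩ := exists_image_point_eq φ
  rw [← himg] at hv hX
  rw [volume_image_point, ofReal_mul_volume_eq_one,
    abs_of_nonneg (Finset.prod_nonneg fun i _ => hx i)] at hv
  exact ⟨x, ⟨hx, hv.ge⟩, fun u hu => hX ⟨u, hu, rfl⟩⟩

/-- An inscribed ellipsoid of volume at least `1` shrinks about its centre to one of volume `1`. -/
theorem containsEllipsoidOfVolumeOne (hd : 1 ≤ d) {X : Set (EuclideanSpace ℝ (Fin d))}
    {x : EllipsoidParam d} (hx : x ∈ detGE d (unitDet d)) (hX : x ∈ inscribed X) :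
    ContainsEllipsoidOfVolumeOne X := by
  have hw := unitDet_pos d
  set D := ∏ i, diag x i with hD
  have hDpos : 0 < D := hw.trans_le hx.2
  set t := (unitDet d / D) ^ ((d : ℝ)⁻¹) with ht
  have hquot : 0 < unitDet d / D := div_pos hw hDpos
  have ht0 : 0 < t := Real.rpow_pos_of_pos hquot _
  have ht1 : t ≤ 1 := Real.rpow_le_one hquot.le ((div_le_one hDpos).2 hx.2) (by positivity)
  have htd : t ^ d = unitDet d / D := Real.rpow_inv_natCast_pow hquot.le (by omega)
  -- The ellipsoid of `x` shrunk by the factor `t` about its centre.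
  have hdet : LinearMap.det (t • Matrix.toEuclideanLin (toMatrix x)) = unitDet d := by
    rw [LinearMap.det_smul, det_toEuclideanLin, finrank_euclideanSpace_fin, htd]
    exact div_mul_cancel₀ _ hDpos.ne'
  let ψ := LinearMap.equivOfDetNeZero (t • Matrix.toEuclideanLin (toMatrix x))
    (by rw [hdet]; exact hw.ne')
  let φ : EuclideanSpace ℝ (Fin d) ≃ᵃ[ℝ] EuclideanSpace ℝ (Fin d) :=
    ψ.toAffineEquiv.trans (AffineEquiv.constVAdd ℝ _ (center x))
  have hφ : ∀ u, φ u = point (t • u) x := by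
    intro u
    rw [point_apply, map_smul, add_comm]; rfl
  refine ⟨φ '' Metric.closedBall 0 1, ⟨φ, rfl⟩, ?_, ?_⟩
  · have : (φ : EuclideanSpace ℝ (Fin d) → _) = (fun v => v + center x) ∘
        (t • Matrix.toEuclideanLin (toMatrix x)) := by
      ext1 u; rw [hφ, point_apply, map_smul]; rfl
    rw [this, Set.image_comp, Set.image_add_right, MeasureTheory.measure_preimage_add_right,
      MeasureTheory.Measure.addHaar_image_linearMap, hdet, abs_of_pos hw,
      ofReal_mul_volume_eq_one]
  · rintro _ ⟨u, hu, rfl⟩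
    rw [hφ]
    refine hX _ ?_
    rw [mem_closedBall_zero_iff] at hu ⊢
    rw [norm_smul, Real.norm_of_nonneg ht0.le]
    exact mul_le_one₀ ht1 (norm_nonneg _) hu

theorem containsEllipsoidOfVolumeOne_univ (hd : 1 ≤ d) :
    ContainsEllipsoidOfVolumeOne (Set.univ : Set (EuclideanSpace ℝ (Fin d))) := by
  have hr : 1 ≤ max 1 (unitDet d) := le_max_left _ _
  refine containsEllipsoidOfVolumeOne hd (x := WithLp.toLp 2 fun _ => max 1 (unitDet d))
    ⟨fun i => zero_le_one.trans hr, ?_⟩ fun _ _ => Set.mem_univ _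
  simp only [diag, Finset.prod_const, Finset.card_univ, Fintype.card_fin]
  exact (le_max_right 1 _).trans (le_self_pow₀ hr (by omega))

/-! ### The colourful theorem for parameters -/

/-- At a minimiser `p` of the norm with determinant at least `w`, one of the `d (d + 3) / 2` sets
can be dropped, provided that they jointly contain an ellipsoid of determinant strictly larger than
`w`. -/
theorem exists_dispensable_inscribed (hd : 1 ≤ d) {w w' : ℝ} (hw : 0 < w) (hww : w < w')
    {C : Fin (d * (d + 3) / 2) → Set (EuclideanSpace ℝ (Fin d))} (hC : ∀ k, Convex ℝ (C k))
    {s : EllipsoidParam d} (hs : s ∈ detGE d w') (hsC : ∀ k, s ∈ inscribed (C k))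
    {p : EllipsoidParam d} (hp : p ∈ detGE d w) (hpC : ∀ k, p ∈ inscribed (C k))
    (hmin : ∀ x ∈ detGE d w, (∀ k, x ∈ inscribed (C k)) → ‖p‖ ≤ ‖x‖) :
    ∃ i, ∀ x ∈ detGE d w, (∀ k, k ≠ i → x ∈ inscribed (C k)) → ‖p‖ ≤ ‖x‖ := by
  have hcol : ∀ k, collapse p ∈ inscribed (C k) := fun k => collapse_mem_inscribed (hpC k)
  have hpw : ∏ i, diag p i = w :=
    prod_diag_eq_of_norm_le hw hd (convex_iInter fun k => convex_inscribed (hC k)) hp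
      (Set.mem_iInter.2 hpC) (Set.mem_iInter.2 hcol)
      fun x hx hx' => hmin x hx (Set.mem_iInter.1 hx')
  refine exists_dispensable_constraint (q := collapse p) (s := s)
    (by rw [finrank_eq, Fintype.card_fin]) (fun k => convex_inscribed (hC k)) hpC hmin
    (tangent p) (fun x hx => ?_) (fun x hx => eventually_mem_detGE hw hp hx) hcol
    (norm_collapse_lt (diag_pos hw hp ⟨0, hd⟩)) ?_ hsC ?_
  · have := le_tangent hw le_rfl hp hpw hx
    rw [div_self hw.ne', Real.log_one, add_zero] at this
    rwa [tangent_self hw hp]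
  · rw [tangent_self hw hp, tangent_apply]
    simp only [diag_collapse, zero_div, Finset.sum_const_zero]
    exact_mod_cast hd
  · have := le_tangent hw hww.le hp hpw hs
    have := Real.log_pos ((one_lt_div hw).2 hww)
    rw [tangent_self hw hp]
    linarith

theorem nonempty_color (hd : 1 ≤ d) : Nonempty (Fin (d * (d + 3) / 2)) :=
  ⟨⟨0, by
    have : 1 * 4 ≤ d * (d + 3) := Nat.mul_le_mul hd (by omega)
    omega⟩⟩

/-- The colourful theorem with an arbitrarily small loss of volume: the determinant drops from `w'`
to any `w < w'`. -/
theorem exists_color_mem_inscribed (hd : 1 ≤ d) {w w' : ℝ} (hw : 0 < w) (hww : w < w')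
    {𝒞 : Fin (d * (d + 3) / 2) → Finset (ConvexBody (EuclideanSpace ℝ (Fin d)))}
    (h𝒞 : ∀ j, (𝒞 j).Nonempty)
    (h : ∀ K : Fin (d * (d + 3) / 2) → ConvexBody (EuclideanSpace ℝ (Fin d)),
      (∀ i, K i ∈ 𝒞 i) → ∃ x ∈ detGE d w', ∀ i, x ∈ inscribed (K i : Set _)) :
    ∃ j, ∃ x ∈ detGE d w, ∀ K ∈ 𝒞 j, x ∈ inscribed (K : Set (EuclideanSpace ℝ (Fin d))) := by
  have := nonempty_color hd
  refine exists_mem_common_of_dispensable h𝒞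
    (Φ := fun K : ConvexBody (EuclideanSpace ℝ (Fin d)) =>
      inscribed (K : Set (EuclideanSpace ℝ (Fin d))))
    (fun K => convex_inscribed K.convex) (fun K => isClosed_inscribed K.isClosed)
    (convex_detGE hw.le) (isClosed_detGE w) (fun S hS => ?_) fun S hS p hp hpS hmin => ?_
  · obtain ⟨x, hx, hxS⟩ := h S hS
    exact ⟨x, detGE_anti hww.le hx, hxS⟩
  · obtain ⟨s, hs, hsS⟩ := h S hS
    exact exists_dispensable_inscribed hd hw hww (fun k => (S k).convex) hs hsS hp hpS hmin

/-- A compact set of parameters avoiding determinant at least `w` also avoids determinant at least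
`w'` for some `w' < w`, since the determinant attains its maximum. -/
theorem exists_lt_disjoint_detGE {A : Set (EllipsoidParam d)} (hA : IsCompact A) {w : ℝ}
    (hw : 0 < w) (h : ∀ x ∈ A, x ∉ detGE d w) :
    ∃ w' < w, 0 < w' ∧ ∀ x ∈ A, x ∉ detGE d w' := by
  let B := A ∩ detGE d 0
  have hB : IsCompact B := hA.inter_right (isClosed_detGE 0)
  rcases B.eq_empty_or_nonempty with hB0 | hB0
  · refine ⟨w / 2, by linarith, by linarith, fun x hx hx' => ?_⟩
    exact (Set.eq_empty_iff_forall_notMem.1 hB0 x) ⟨hx, detGE_anti (by linarith) hx'⟩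
  · obtain ⟨y, hy, hmax⟩ := hB.exists_isMaxOn hB0
      (continuous_finsetProd Finset.univ fun i _ => continuous_diag (d := d) i).continuousOn
    have hyw : ∏ i, diag y i < w := not_le.1 fun hle => h y hy.1 ⟨hy.2.1, hle⟩
    refine ⟨(∏ i, diag y i + w) / 2, by linarith, by linarith [hy.2.2], fun x hx hx' => ?_⟩
    have : ∏ i, diag x i ≤ ∏ i, diag y i :=
      hmax ⟨hx, detGE_anti (by linarith [hy.2.2]) hx'⟩
    linarith [hx'.2]

end EllipsoidParam

open EllipsoidParam in
theorem mainTheorem3 (d : ℕ) (hd : 1 ≤ d)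
    (𝒞 : Fin (d * (d + 3) / 2) → Finset (ConvexBody (EuclideanSpace ℝ (Fin d))))
    (h : ∀ K : Fin (d * (d + 3) / 2) → ConvexBody (EuclideanSpace ℝ (Fin d)),
      (∀ i, K i ∈ 𝒞 i) →
        ContainsEllipsoidOfVolumeOne (⋂ i, (K i : Set (EuclideanSpace ℝ (Fin d))))) :
    ∃ j, ContainsEllipsoidOfVolumeOne (⋂ K ∈ 𝒞 j, (K : Set (EuclideanSpace ℝ (Fin d)))) := by
  by_cases hne : ∀ j, (𝒞 j).Nonempty
  swap
  · simp only [not_forall, Finset.not_nonempty_iff_eq_empty] at hne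
    obtain ⟨j, hj⟩ := hne
    refine ⟨j, ?_⟩
    rw [hj]
    simpa using containsEllipsoidOfVolumeOne_univ hd
  have hw := unitDet_pos d
  have h' : ∀ K : Fin (d * (d + 3) / 2) → ConvexBody (EuclideanSpace ℝ (Fin d)),
      (∀ i, K i ∈ 𝒞 i) → ∃ x ∈ detGE d (unitDet d), ∀ i, x ∈ inscribed (K i : Set _) := by
    intro K hK
    obtain ⟨x, hx, hxK⟩ := exists_mem_inscribed (h K hK)
    exact ⟨x, hx, fun i u hu => Set.mem_iInter.1 (hxK u hu) i⟩
  by_contra! hcon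
  let A : Fin (d * (d + 3) / 2) → Set (EllipsoidParam d) := fun j =>
    inscribed (⋂ K ∈ 𝒞 j, (K : Set (EuclideanSpace ℝ (Fin d))))
  have hA : ∀ j, IsCompact (A j) := fun j => by
    obtain ⟨K, hK⟩ := hne j
    exact Metric.isCompact_of_isClosed_isBounded
      (isClosed_inscribed (isClosed_biInter fun K _ => K.isCompact.isClosed))
      (isBounded_inscribed (K.isBounded.subset (Set.biInter_subset_of_mem hK)))
  -- If no colour works, some determinant below `unitDet d` is still out of reach of every colour.
  have hgap := fun j => exists_lt_disjoint_detGE (hA j) hw fun x hxA hx =>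
    hcon j (containsEllipsoidOfVolumeOne hd hx hxA)
  choose w hwlt hwpos hwdisj using hgap
  have := nonempty_color hd
  obtain ⟨j₀, hj₀⟩ := Finite.exists_max w
  obtain ⟨j, x, hx, hxK⟩ := exists_color_mem_inscribed hd (hwpos j₀) (hwlt j₀) hne h'
  exact hwdisj j x (fun u hu => Set.mem_iInter₂.2 fun K hK => hxK K hK u hu)
    (detGE_anti (hj₀ j) hx)
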